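/- Let $\mathcal U,\mathcal X,\mathcal Y,\mathcal V,\mathcal Z$ be finite sets with $|\mathcal U|=J$, $|\mathcal X|=K$, $|\mathcal Y|=L$, $|\mathcal V|=M$, $|\mathcal Z|=s$, let $\rho:\mathcal U\times\mathcal V\to\mathbb R$ be a distortion measure, let $\ell\ge 1$ and $d\ge 0$ be integers, and let $\log$ be the logarithm to a fixed base greater than $1$. A deterministic source sequence $u=(u_1,u_2,\ldots)$ over $\mathcal U$ is mapped by an arbitrary (deterministic) encoder to a sequence $x=(x_1,x_2,\ldots)$ over $\mathcal X$, which is sent through a discrete memoryless channel with transition probabilities $P(y|x)$, $x\in\mathcal X$, $y\in\mathcal Y$, so that the output $Y^n$ has the law $\prod_{t=1}^nP(y_t|x_t)$. Let $C=\max_{P_X}I(X;Y)$ be its capacity. The decoder has the state set $\mathcal Z$ and a modulo-$\ell$ counter: it starts in a fixed state $z_1\in\mathcal Z$ and, with $\tau=t \bmod \ell$, $$V_{t-d}=f_\tau(Z_t,Y_t)\quad(d<t\le n),\qquad Z_{t+1}=g_\tau(Z_t,Y_t)\quad(1\le t\le n),$$ where $Z_1=z_1$ and $f_\tau:\mathcal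 Z\times\mathcal Y\to\mathcal V$, $g_\tau:\mathcal Z\times\mathcal Y\to\mathcal Z$ are arbitrary. The symbols $V_t$ with $t\le n$ and $t>n-d$, which are not yet reconstructed at time $n$, are arbitrary elements of $\mathcal V$ (possibly depending on $Y^n$). Suppose that $n\ge1$ and that $\ell$ divides $n$. Let $\hat P_{U^\ell}$ be the empirical distribution of the $n/\ell$ non-overlapping blocks $(u_{i\ell+1},\ldots,u_{i\ell+\ell})$, $0\le i<n/\ell$, and let $$\hat D_{U^\ell}(R)=\min\Big\{\tfrac1\ell\,\mathbb E\sum_{j=1}^\ell\rho(U_j,\tilde V_j)\;:\; I(U^\ell;\tilde V^\ell)\le \ell R\Big\},$$ where $(U^\ell,\tilde V^\ell)$ has the law $\hat P_{U^\ell}P_{\tilde V^\ell|U^\ell}$, the minimum is over all conditional distributions $P_{\tilde V^\ell|U^\ell}$ on $\mathcal V^\ell$ given $\mathcal U^\ell$, and $\hat D_{U^\ell}(R)=+\infty$ for $R<0$. Then $$\frac1n\sum_{t=1}^n\mathbb E\,\rho(u_t,V_t)\;\ge\;\hat D_{U^\ell}\Big(C+\frac{2\log s+d\log M}{\ell}+\delta_1(\ell,n)\Big),$$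 where $$\delta_1(\ell,n)=\frac{(JK)^\ell\log L}{\sqrt n}+\frac{(JKL)^\ell\log e}{2n}+o\Big(\frac1{\sqrt n}\Big).$$ Here the $o(1/\sqrt n)$ term, as $n\to\infty$ with $\ell$ fixed, is a function of $n$ that depends only on $\ell$, $J$, $K$, $L$ and the base of the logarithm; it is the same for all channels, distortion measures, source sequences, encoders, decoders, reconstruction alphabets $\mathcal V$, state sets $\mathcal Z$ and delays $d$. -/

import Mathlib

open Filter Asymptotics

namespace SemiDet

noncomputable section

/-- Mutual information, in logarithms to the base `b`, of a pair of finite random variables with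
joint probability mass function `P`. -/
def mutualInfo (b : ℝ) {A B : Type*} [Fintype A] [Fintype B] (P : A → B → ℝ) : ℝ :=
  ∑ x, ∑ y, P x y * Real.logb b (P x y / ((∑ y', P x y') * ∑ x', P x' y))

/-- `W` is a matrix of transition probabilities: each row `W x` is a probability vector. -/
def IsChannel {A B : Type*} [Fintype B] (W : A → B → ℝ) : Prop :=
  ∀ x, W x ∈ stdSimplex ℝ B

/-- Capacity of the discrete memoryless channel `W`: the largest mutual information
`I(X;Y)` over all input distributions `p`. -/
def capacity (b : ℝ) {X Y : Type*} [Fintype X] [Fintype Y] (W : X → Y → ℝ) : ℝ :=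
  sSup ((fun p : X → ℝ => mutualInfo b (fun x y => p x * W x y)) '' stdSimplex ℝ X)

/-- The `i`-th non-overlapping block of length `ℓ` (`i = 0, 1, …`). Sequences are indexed from `0`,
so entry `t` of a sequence is the symbol at time `t + 1`. -/
def block {U : Type*} (ℓ : ℕ) (u : ℕ → U) (i : ℕ) : Fin ℓ → U :=
  fun j => u (i * ℓ + j)

open Classical in
/-- Empirical distribution of the `n / ℓ` non-overlapping `ℓ`-blocks of `u^n`. -/
def empirical {U : Type*} (ℓ n : ℕ) (u : ℕ → U) (a : Fin ℓ → U) : ℝ :=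
  (ℓ : ℝ) / n * ∑ i ∈ Finset.range (n / ℓ), if block ℓ u i = a then 1 else 0

/-- Expected (additive) distortion between `ℓ`-vectors: `a` is drawn from `p`, and given `a`, the
reproduction is drawn from `Q a`. -/
def blockDistortion {U V : Type*} [Fintype U] [Fintype V] (ρ : U → V → ℝ) {ℓ : ℕ}
    (p : (Fin ℓ → U) → ℝ) (Q : (Fin ℓ → U) → (Fin ℓ → V) → ℝ) : ℝ :=
  ∑ a, ∑ c, p a * Q a c * ∑ j, ρ (a j) (c j)

/-- The `ℓ`-th order empirical distortion-rate function of `u^n`: the least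
`(1/ℓ) E ρ(U^ℓ, V^ℓ)` over all conditional distributions `Q` of `V^ℓ` given `U^ℓ` such that
`I(U^ℓ; V^ℓ) ≤ ℓ R`, where `U^ℓ` has the empirical distribution.
It is `⊤` if there is no such `Q` (that is, for `R < 0`). -/
def empiricalDistortionRate (b : ℝ) {U V : Type*} [Fintype U] [Fintype V] (ρ : U → V → ℝ)
    (ℓ n : ℕ) (u : ℕ → U) (R : ℝ) : EReal :=
  ⨅ Q ∈ {Q : (Fin ℓ → U) → (Fin ℓ → V) → ℝ | IsChannel Q ∧
      mutualInfo b (fun a c => empirical ℓ n u a * Q a c) ≤ ℓ * R},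
    ((1 / (ℓ : ℝ) * blockDistortion ρ (empirical ℓ n u) Q : ℝ) : EReal)

/-- A finite-state decoder with state set `Z`, equipped with a modulo-`ℓ` counter. -/
structure Decoder (ℓ : ℕ) (Y Z V : Type*) where
  /-- The initial state `z₁`. -/
  init : Z
  /-- The next-state functions `g_τ`. -/
  next : ZMod ℓ → Z → Y → Z
  /-- The output functions `f_τ`. -/
  out : ZMod ℓ → Z → Y → V

namespace Decoder

variable {ℓ : ℕ} {Y Z V : Type*}

/-- `dec.state y t` is the state `z_{t+1}`: `z_{t+1} = g_τ(z_t, y_t)` with `τ = t mod ℓ`. Only the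
states up to time `n + 1` are meaningful, those after it are never used. -/
def state (dec : Decoder ℓ Y Z V) {n : ℕ} (y : Fin n → Y) : ℕ → Z
  | 0 => dec.init
  | t + 1 =>
    if h : t < n then dec.next ((t + 1 : ℕ) : ZMod ℓ) (dec.state y t) (y ⟨t, h⟩)
    else dec.state y t

/-- The reconstruction with delay `d`: `v_{t-d} = f_τ(z_t, y_t)` with `τ = t mod ℓ` for
`d < t ≤ n`. The last `d` symbols, not yet reconstructed at time `n`, are given by `tail`. -/
def reconstruct (dec : Decoder ℓ Y Z V) (d : ℕ) {n : ℕ} (tail : (Fin n → Y) → ℕ → V)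
    (y : Fin n → Y) (t : ℕ) : V :=
  if h : t + d < n then dec.out ((t + d + 1 : ℕ) : ZMod ℓ) (dec.state y (t + d)) (y ⟨t + d, h⟩)
  else tail y t

end Decoder

/-- Expectation of `F(Y^n)`, where `Y^n` is the output of the memoryless channel `W` for the
input `x^n`. -/
def channelExpectation {X Y : Type*} [Fintype Y] (W : X → Y → ℝ) {n : ℕ} (x : ℕ → X)
    (F : (Fin n → Y) → ℝ) : ℝ :=
  ∑ y : Fin n → Y, (∏ t : Fin n, W (x t) (y t)) * F y

end

end SemiDet

/-!
Let `T` be uniform on the blocks. The pair consisting of the `T`-th source block and the `T`-th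
reconstructed block has the empirical law as its first marginal and the actual distortion as its
expected distortion, so it suffices to bound its mutual information. The source block is a function
of `T`, and the reconstructed block is a function of the `T`-th channel output block, the decoder
state at its beginning, and its own last `d` symbols. By data processing the mutual information is
at most `I(T; Y^ℓ) + log s + d log M`. Given `T` the outputs are independent and each is produced by
the channel from an input determined by `T`, so `I(T; Y^ℓ) ≤ ℓ C`. This bound is exact for every
`n`, so the correction `δ₁` is obtained with a zero `o(1/√n)` term.
-/

namespace SemiDet

open Real Finset

theorem nonempty_of_mem_stdSimplex {ι : Type*} [Fintype ι] {p : ι → ℝ}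
    (hp : p ∈ stdSimplex ℝ ι) : Nonempty ι := by
  by_contra hι
  rw [not_nonempty_iff] at hι
  simp [stdSimplex_of_isEmpty_index] at hp

theorem uniform_mem_stdSimplex (ι : Type*) [Fintype ι] [Nonempty ι] :
    (fun _ : ι => (Fintype.card ι : ℝ)⁻¹) ∈ stdSimplex ℝ ι :=
  stdSimplex.barycenter.2

section Law

variable {Ω A B : Type*} [Fintype Ω]

open Classical in
/-- The law of the random variable `f` on a finite sample space whose points have weights `p`. -/
noncomputable def law (p : Ω → ℝ) (f : Ω → A) (a : A) : ℝ :=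
  ∑ ω with f ω = a, p ω

/-- The joint law of the random variables `f` and `g`, in the curried form expected by
`mutualInfo`. -/
noncomputable def jointLaw (p : Ω → ℝ) (f : Ω → A) (g : Ω → B) (a : A) (c : B) : ℝ :=
  law p (fun ω => (f ω, g ω)) (a, c)

/-- The product of two weight functions: the joint law of independent random elements. -/
def prodLaw (p : A → ℝ) (q : B → ℝ) (k : A × B) : ℝ :=
  p k.1 * q k.2

theorem law_nonneg {p : Ω → ℝ} (hp : ∀ ω, 0 ≤ p ω) (f : Ω → A) (a : A) : 0 ≤ law p f a :=
  sum_nonneg fun ω _ => hp ω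

theorem law_apply_pos {p : Ω → ℝ} (hp : ∀ ω, 0 ≤ p ω) (f : Ω → A) {ω : Ω} (hω : 0 < p ω) :
    0 < law p f (f ω) :=
  sum_pos' (fun ω' _ => hp ω') ⟨ω, by simp, hω⟩

theorem law_le_law_comp {p : Ω → ℝ} (hp : ∀ ω, 0 ≤ p ω) (f : Ω → A) (g : A → B) (a : A) :
    law p f a ≤ law p (g ∘ f) (g a) := by
  refine sum_le_sum_of_subset_of_nonneg (fun ω hω => ?_) fun ω _ _ => hp ω
  simp only [mem_filter, mem_univ, true_and] at hω
  simp [hω]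

theorem law_eq_zero_of_law_comp_eq_zero {p : Ω → ℝ} (hp : ∀ ω, 0 ≤ p ω) {f : Ω → A} (g : A → B)
    {a : A} (h : law p (g ∘ f) (g a) = 0) : law p f a = 0 :=
  le_antisymm ((law_le_law_comp hp f g a).trans_eq h) (law_nonneg hp f a)

theorem sum_law_mul [Fintype A] (p : Ω → ℝ) (f : Ω → A) (F : A → ℝ) :
    ∑ a, law p f a * F a = ∑ ω, p ω * F (f ω) := by
  classical
  rw [← sum_fiberwise univ f]
  refine sum_congr rfl fun a _ => ?_
  rw [law, sum_mul]
  exact sum_congr rfl fun ω hω => by rw [(mem_filter.1 hω).2]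

theorem sum_law [Fintype A] (p : Ω → ℝ) (f : Ω → A) : ∑ a, law p f a = ∑ ω, p ω := by
  simpa using sum_law_mul p f 1

theorem law_mem_stdSimplex [Fintype A] {p : Ω → ℝ} (hp : p ∈ stdSimplex ℝ Ω) (f : Ω → A) :
    law p f ∈ stdSimplex ℝ A :=
  ⟨law_nonneg hp.1 f, (sum_law p f).trans hp.2⟩

theorem law_id (p : Ω → ℝ) : law p id = p := by
  classical
  funext ω
  simp [law, sum_filter]

theorem law_law [Fintype A] (p : Ω → ℝ) (f : Ω → A) (g : A → B) :
    law (law p f) g = law p (g ∘ f) := by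
  classical
  funext c
  simpa [law, sum_filter] using sum_law_mul p f fun a => if g a = c then 1 else 0

theorem sum_jointLaw_right [Fintype B] (p : Ω → ℝ) (f : Ω → A) (g : Ω → B) (a : A) :
    ∑ c, jointLaw p f g a c = law p f a := by
  classical
  simp only [jointLaw, law, sum_filter, Prod.mk.injEq]
  rw [sum_comm]
  simp [ite_and]

theorem sum_jointLaw_left [Fintype A] (p : Ω → ℝ) (f : Ω → A) (g : Ω → B) (c : B) :
    ∑ a, jointLaw p f g a c = law p g c := by
  classical
  simp only [jointLaw, law, sum_filter, Prod.mk.injEq]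
  rw [sum_comm]
  simp [ite_and]

theorem jointLaw_fst_snd [Fintype A] [Fintype B] (P : A → B → ℝ) :
    jointLaw (fun k : A × B => P k.1 k.2) Prod.fst Prod.snd = P := by
  classical
  funext a c
  simp [jointLaw, law, filter_eq']

theorem prodLaw_mem_stdSimplex [Fintype A] [Fintype B] {p : A → ℝ} {q : B → ℝ}
    (hp : p ∈ stdSimplex ℝ A) (hq : q ∈ stdSimplex ℝ B) :
    prodLaw p q ∈ stdSimplex ℝ (A × B) := by
  refine ⟨fun k => mul_nonneg (hp.1 _) (hq.1 _), ?_⟩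
  simp only [prodLaw, Fintype.sum_prod_type, ← mul_sum, hq.2, mul_one, hp.2]

theorem law_prodLaw_map {A' B' : Type*} [Fintype A] [Fintype B] (p : A → ℝ) (q : B → ℝ)
    (f : A → A') (g : B → B') :
    law (prodLaw p q) (Prod.map f g) = prodLaw (law p f) (law q g) := by
  classical
  funext k
  simp only [law, prodLaw, sum_mul_sum, ← sum_product']
  refine sum_congr ?_ fun _ _ => rfl
  ext
  simp [Prod.ext_iff]

theorem jointLaw_prodLaw_fst [Fintype A] (p : A → ℝ) (q : Ω → ℝ) (g : A → Ω → B) (a : A)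
    (c : B) :
    jointLaw (prodLaw p q) Prod.fst (fun k => g k.1 k.2) a c = p a * law q (g a) c := by
  classical
  simp only [jointLaw, law, prodLaw, sum_filter, Prod.mk.injEq, Fintype.sum_prod_type, ite_and,
    mul_sum, mul_ite, mul_zero]
  rw [Fintype.sum_eq_single a fun a' ha' => by simp [ha']]
  simp

theorem law_prodLaw_fst [Fintype A] (p : A → ℝ) {q : Ω → ℝ} (hq : ∑ ω, q ω = 1) (f : A → B) :
    law (prodLaw p q) (fun k => f k.1) = law p f := by
  classical
  funext c
  simp only [law, prodLaw, sum_filter, Fintype.sum_prod_type]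
  refine sum_congr rfl fun a _ => ?_
  split_ifs <;> simp [← mul_sum, hq]

end Law

section Divergence

/-- The divergence (relative entropy) `D(P‖Q)`, in logarithms to the base `b`. It has its usual
meaning only if `P` vanishes wherever `Q` does. -/
noncomputable def divergence (b : ℝ) {κ : Type*} [Fintype κ] (P Q : κ → ℝ) : ℝ :=
  ∑ k, P k * logb b (P k / Q k)

theorem sum_mul_logb_sum_div_sum_le {ι : Type*} {b : ℝ} (hb : 1 < b) (s : Finset ι)
    {P Q : ι → ℝ} (hP : ∀ i ∈ s, 0 ≤ P i) (hQ : ∀ i ∈ s, 0 ≤ Q i)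
    (hPQ : ∀ i ∈ s, Q i = 0 → P i = 0) :
    (∑ i ∈ s, P i) * logb b ((∑ i ∈ s, P i) / ∑ i ∈ s, Q i)
      ≤ ∑ i ∈ s, P i * logb b (P i / Q i) := by
  simp only [logb, ← mul_div_assoc, ← sum_div]
  refine div_le_div_of_nonneg_right ?_ (log_pos hb).le
  rcases (sum_nonneg hQ).eq_or_lt with hQ0 | hQpos
  · have hPs : ∀ i ∈ s, P i = 0 :=
      fun i hi => hPQ i hi ((sum_eq_zero_iff_of_nonneg hQ).1 hQ0.symm i hi)
    rw [sum_eq_zero hPs, zero_mul, sum_eq_zero fun i hi => mul_eq_zero_of_left (hPs i hi) _]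
  · have hcancel : ∀ i ∈ s, Q i * (P i / Q i) = P i :=
      fun i hi => mul_div_cancel_of_imp' (hPQ i hi)
    have hjensen := convexOn_mul_log.map_centerMass_le hQ hQpos
      (p := fun i => P i / Q i) fun i hi => div_nonneg (hP i hi) (hQ i hi)
    have hsum : ∑ i ∈ s, Q i * (P i / Q i) * log (P i / Q i) = ∑ i ∈ s, P i * log (P i / Q i) :=
      sum_congr rfl fun i hi => by rw [hcancel i hi]
    simp only [centerMass, smul_eq_mul, Function.comp_apply, ← mul_assoc] at hjensen
    rw [sum_congr rfl hcancel, hsum, mul_assoc, inv_mul_eq_div _ (∑ i ∈ s, P i)] at hjensen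
    exact le_of_mul_le_mul_left hjensen (inv_pos.2 hQpos)

theorem divergence_nonneg {κ : Type*} [Fintype κ] {b : ℝ} (hb : 1 < b) {P Q : κ → ℝ}
    (hP : P ∈ stdSimplex ℝ κ) (hQ : Q ∈ stdSimplex ℝ κ) (hPQ : ∀ k, Q k = 0 → P k = 0) :
    0 ≤ divergence b P Q := by
  have h := sum_mul_logb_sum_div_sum_le hb univ (fun k _ => hP.1 k) (fun k _ => hQ.1 k)
    fun k _ => hPQ k
  rwa [hP.2, hQ.2, div_one, logb_one, mul_zero] at h

theorem divergence_law_le {κ A : Type*} [Fintype κ] [Fintype A] {b : ℝ} (hb : 1 < b)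
    {P Q : κ → ℝ} (hP : ∀ k, 0 ≤ P k) (hQ : ∀ k, 0 ≤ Q k) (hPQ : ∀ k, Q k = 0 → P k = 0)
    (f : κ → A) : divergence b (law P f) (law Q f) ≤ divergence b P Q := by
  classical
  rw [divergence, divergence, ← sum_fiberwise univ f]
  exact sum_le_sum fun a _ => sum_mul_logb_sum_div_sum_le hb _ (fun k _ => hP k)
    (fun k _ => hQ k) fun k _ => hPQ k

end Divergence

section MutualInfo

variable {Ω A B S : Type*} [Fintype Ω] [Fintype A] [Fintype B] {b : ℝ} {p : Ω → ℝ}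

theorem mutualInfo_jointLaw (p : Ω → ℝ) (f : Ω → A) (g : Ω → B) :
    mutualInfo b (jointLaw p f g) =
      ∑ ω, p ω * logb b (jointLaw p f g (f ω) (g ω) / (law p f (f ω) * law p g (g ω))) := by
  simp only [mutualInfo, sum_jointLaw_right, sum_jointLaw_left, ← Fintype.sum_prod_type']
  exact sum_law_mul p (fun ω => (f ω, g ω))
    fun k => logb b (jointLaw p f g k.1 k.2 / (law p f k.1 * law p g k.2))

theorem mutualInfo_jointLaw_eq_divergence (p : Ω → ℝ) (f : Ω → A) (g : Ω → B) :
    mutualInfo b (jointLaw p f g) =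
      divergence b (law p fun ω => (f ω, g ω)) (prodLaw (law p f) (law p g)) := by
  simp only [mutualInfo, sum_jointLaw_right, sum_jointLaw_left, ← Fintype.sum_prod_type']
  rfl

theorem mutualInfo_jointLaw_comp_le {A' B' : Type*} [Fintype A'] [Fintype B'] (hb : 1 < b)
    (hp : ∀ ω, 0 ≤ p ω) (f : Ω → A) (g : Ω → B) (φ : A → A') (ψ : B → B') :
    mutualInfo b (jointLaw p (φ ∘ f) (ψ ∘ g)) ≤ mutualInfo b (jointLaw p f g) := by
  have hjoint : law p (fun ω => ((φ ∘ f) ω, (ψ ∘ g) ω)) =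
      law (law p fun ω => (f ω, g ω)) (Prod.map φ ψ) :=
    (law_law p (fun ω => (f ω, g ω)) (Prod.map φ ψ)).symm
  have hprod : prodLaw (law p (φ ∘ f)) (law p (ψ ∘ g)) =
      law (prodLaw (law p f) (law p g)) (Prod.map φ ψ) := by
    rw [law_prodLaw_map, law_law, law_law]
  rw [mutualInfo_jointLaw_eq_divergence, mutualInfo_jointLaw_eq_divergence, hjoint, hprod]
  refine divergence_law_le hb (law_nonneg hp _)
    (fun k => mul_nonneg (law_nonneg hp f _) (law_nonneg hp g _)) (fun k hk => ?_) _
  rcases mul_eq_zero.1 hk with h | h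
  · exact law_eq_zero_of_law_comp_eq_zero hp Prod.fst h
  · exact law_eq_zero_of_law_comp_eq_zero hp Prod.snd h

theorem mutualInfo_jointLaw_le_of_factorsThrough {A' B' : Type*} [Fintype A'] [Fintype B']
    [Nonempty A'] [Nonempty B'] (hb : 1 < b) (hp : ∀ ω, 0 ≤ p ω) {f : Ω → A} {g : Ω → B}
    {f' : Ω → A'} {g' : Ω → B'} (hf : f'.FactorsThrough f) (hg : g'.FactorsThrough g) :
    mutualInfo b (jointLaw p f' g') ≤ mutualInfo b (jointLaw p f g) := by
  obtain ⟨φ, rfl⟩ := (Function.factorsThrough_iff f').1 hf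
  obtain ⟨ψ, rfl⟩ := (Function.factorsThrough_iff g').1 hg
  exact mutualInfo_jointLaw_comp_le hb hp f g φ ψ

theorem mutualInfo_jointLaw_le_sum_mul_logb (hb : 1 < b) (hp : p ∈ stdSimplex ℝ Ω) (f : Ω → A)
    (g : Ω → B) {q : B → ℝ} (hq : q ∈ stdSimplex ℝ B) (hgq : ∀ c, q c = 0 → law p g c = 0) :
    mutualInfo b (jointLaw p f g) ≤
      ∑ ω, p ω * logb b (jointLaw p f g (f ω) (g ω) / (law p f (f ω) * q (g ω))) := by
  -- The right-hand side exceeds the left-hand side by the divergence of the law of `g` from `q`.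
  have hgain : 0 ≤ ∑ ω, p ω * logb b (law p g (g ω) / q (g ω)) := by
    rw [← sum_law_mul p g fun c => logb b (law p g c / q c)]
    exact divergence_nonneg hb (law_mem_stdSimplex hp g) hq hgq
  refine (le_add_of_nonneg_right hgain).trans_eq ?_
  rw [mutualInfo_jointLaw, ← sum_add_distrib]
  refine sum_congr rfl fun ω _ => ?_
  rcases (hp.1 ω).eq_or_lt with hω | hω
  · simp [← hω]
  have hf := law_apply_pos hp.1 f hω
  have hg := law_apply_pos hp.1 g hω
  have hfg : 0 < jointLaw p f g (f ω) (g ω) := law_apply_pos hp.1 _ hω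
  have hqω : q (g ω) ≠ 0 := fun h => hg.ne' (hgq _ h)
  rw [← mul_add, ← logb_mul (by positivity) (by positivity)]
  congr 2
  field_simp

theorem mutualInfo_jointLaw_prodMk_le [Fintype S] (hb : 1 < b) (hp : p ∈ stdSimplex ℝ Ω)
    (f : Ω → A) (g : Ω → B) (h : Ω → S) :
    mutualInfo b (jointLaw p f fun ω => (g ω, h ω)) ≤
      mutualInfo b (jointLaw p f g) + logb b (Fintype.card S) := by
  obtain ⟨ω₀⟩ := nonempty_of_mem_stdSimplex hp
  have : Nonempty S := ⟨h ω₀⟩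
  have hS : (0 : ℝ) < Fintype.card S := by exact_mod_cast Fintype.card_pos
  have hq := prodLaw_mem_stdSimplex (law_mem_stdSimplex hp g) (uniform_mem_stdSimplex S)
  refine (mutualInfo_jointLaw_le_sum_mul_logb hb hp f _ hq fun k hk =>
    law_eq_zero_of_law_comp_eq_zero (f := fun ω => (g ω, h ω)) hp.1 Prod.fst
      ((mul_eq_zero.1 hk).resolve_right (by positivity))).trans ?_
  rw [mutualInfo_jointLaw, ← one_mul (logb b (Fintype.card S)), ← hp.2, sum_mul,
    ← sum_add_distrib]
  refine sum_le_sum fun ω _ => ?_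
  rw [← mul_add]
  rcases (hp.1 ω).eq_or_lt with hω | hω
  · simp [← hω]
  have hf := law_apply_pos hp.1 f hω
  have hg := law_apply_pos hp.1 g hω
  have hfg : 0 < jointLaw p f g (f ω) (g ω) := law_apply_pos hp.1 _ hω
  have hfgh : 0 < jointLaw p f (fun ω => (g ω, h ω)) (f ω) (g ω, h ω) :=
    law_apply_pos hp.1 _ hω
  have hle : jointLaw p f (fun ω => (g ω, h ω)) (f ω) (g ω, h ω) ≤ jointLaw p f g (f ω) (g ω) :=
    law_le_law_comp hp.1 (fun ω => (f ω, g ω, h ω)) (fun k => (k.1, k.2.1)) (f ω, g ω, h ω)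
  refine mul_le_mul_of_nonneg_left ?_ hω.le
  rw [← logb_mul (by positivity) hS.ne']
  refine logb_le_logb_of_le hb (by unfold prodLaw; positivity) ?_
  rw [prodLaw, ← mul_assoc, ← div_div, div_inv_eq_mul]
  gcongr

theorem mutualInfo_jointLaw_le_logb_card (hb : 1 < b) (hp : p ∈ stdSimplex ℝ Ω) (f : Ω → A)
    (g : Ω → B) : mutualInfo b (jointLaw p f g) ≤ logb b (Fintype.card B) := by
  have hconst : mutualInfo b (jointLaw p f fun _ => ()) = 0 := by
    have hone : law p (fun _ => ()) () = 1 := by simp [law, hp.2]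
    simp only [mutualInfo, sum_jointLaw_left, univ_unique, sum_singleton, PUnit.default_eq_unit,
      hone, mul_one]
    refine sum_eq_zero fun a _ => ?_
    by_cases h : jointLaw p f (fun _ => ()) a () = 0 <;> simp [h]
  have h := mutualInfo_jointLaw_prodMk_le hb hp f (fun _ => ()) g
  rw [hconst, zero_add] at h
  exact (mutualInfo_jointLaw_comp_le hb hp.1 f (fun ω => ((), g ω)) id Prod.snd).trans h

end MutualInfo

section ProductLaw

variable {κ ι Y : Type*} [Fintype κ]

/-- The law of independent random variables indexed by `κ`, the one with index `t` having the
law `K t`. With `K t = W (x t)` this is the output law of the memoryless channel `W` for the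
input `x`. -/
def piLaw (K : κ → Y → ℝ) (ω : κ → Y) : ℝ :=
  ∏ t, K t (ω t)

theorem piLaw_mem_stdSimplex [DecidableEq κ] [Fintype Y] {K : κ → Y → ℝ} (hK : IsChannel K) :
    piLaw K ∈ stdSimplex ℝ (κ → Y) := by
  refine ⟨fun ω => prod_nonneg fun t _ => (hK t).1 _, ?_⟩
  simp only [piLaw, ← Fintype.prod_sum, (hK _).2, prod_const_one]

theorem law_piLaw_comp [DecidableEq κ] [Fintype ι] [Fintype Y] {K : κ → Y → ℝ}
    (hK : IsChannel K) {e : ι → κ} (he : Function.Injective e) :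
    law (piLaw K) (fun ω => ω ∘ e) = piLaw (K ∘ e) := by
  classical
  funext y
  have hfiber : (univ.filter fun ω : κ → Y => ω ∘ e = y) =
      Fintype.piFinset fun t => univ.filter fun z => ∀ j, e j = t → z = y j := by
    ext ω
    simp only [mem_filter, mem_univ, true_and, Fintype.mem_piFinset, funext_iff,
      Function.comp_apply]
    exact ⟨fun h t j hj => hj ▸ h j, fun h j => h _ j rfl⟩
  simp only [law, piLaw, Function.comp_apply]
  rw [hfiber, ← prod_univ_sum]
  symm
  refine Fintype.prod_of_injective e he _ _ (fun t ht => ?_) fun j => ?_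
  · rw [← (hK t).2, filter_true_of_mem fun z _ j hj => absurd ⟨j, hj⟩ ht]
  · simp [he.eq_iff, sum_filter]

theorem law_piLaw_apply [DecidableEq κ] [Fintype Y] {K : κ → Y → ℝ} (hK : IsChannel K) (t : κ) :
    law (piLaw K) (fun ω => ω t) = K t := by
  classical
  funext z
  have h := congrFun (law_piLaw_comp hK (Function.injective_of_subsingleton fun _ : Unit => t))
    fun _ => z
  simpa [law, piLaw, funext_iff] using h

theorem mutualInfo_jointLaw_le_sum_of_condIndep {Ω A : Type*} [Fintype Ω] [Fintype A] [Fintype ι]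
    [DecidableEq ι] [Fintype Y] {b : ℝ} (hb : 1 < b) {p : Ω → ℝ} (hp : p ∈ stdSimplex ℝ Ω)
    (f : Ω → A) (g : Ω → ι → Y)
    (hcond : ∀ a y, jointLaw p f g a y =
      law p f a * ∏ j, jointLaw p f (fun ω => g ω j) a (y j) / law p f a) :
    mutualInfo b (jointLaw p f g) ≤ ∑ j, mutualInfo b (jointLaw p f fun ω => g ω j) := by
  have hq : piLaw (fun j => law p fun ω => g ω j) ∈ stdSimplex ℝ (ι → Y) :=
    piLaw_mem_stdSimplex fun j => law_mem_stdSimplex hp _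
  refine (mutualInfo_jointLaw_le_sum_mul_logb hb hp f g hq fun y hy => ?_).trans_eq ?_
  · obtain ⟨j, -, hj⟩ := prod_eq_zero_iff.1 hy
    exact law_eq_zero_of_law_comp_eq_zero hp.1 (fun y : ι → Y => y j) hj
  simp only [mutualInfo_jointLaw]
  rw [sum_comm]
  refine sum_congr rfl fun ω _ => ?_
  rw [← mul_sum]
  rcases (hp.1 ω).eq_or_lt with hω | hω
  · simp [← hω]
  have hf := law_apply_pos hp.1 f hω
  rw [← logb_prod]
  · simp only [hcond, piLaw, mul_div_mul_left _ _ hf.ne', ← prod_div_distrib, div_div]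
  · intro j _
    have hfg : 0 < jointLaw p f (fun ω => g ω j) (f ω) (g ω j) := law_apply_pos hp.1 _ hω
    have hg := law_apply_pos hp.1 (fun ω => g ω j) hω
    positivity

end ProductLaw

section Channel

variable {I X Y : Type*} [Fintype I] [Fintype X] [Fintype Y] {b : ℝ} {W : X → Y → ℝ}

theorem mutualInfo_channel (p : X → ℝ) (hW : IsChannel W) :
    mutualInfo b (fun x y => p x * W x y) =
      ∑ x, p x * divergence b (W x) fun y => ∑ x', p x' * W x' y := by
  unfold mutualInfo divergence
  refine sum_congr rfl fun x _ => ?_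
  rw [mul_sum, ← mul_sum univ (W x), (hW x).2, mul_one]
  refine sum_congr rfl fun y _ => ?_
  rw [mul_assoc]
  by_cases hx : p x = 0
  · simp [hx]
  · rw [mul_div_mul_left _ _ hx]

theorem mutualInfo_channel_comp (p : I → ℝ) (hW : IsChannel W) (x : I → X) :
    mutualInfo b (fun i y => p i * W (x i) y) = mutualInfo b fun a y => law p x a * W a y := by
  simp only [mutualInfo_channel p fun i => hW (x i), mutualInfo_channel _ hW, sum_law_mul]

theorem mutualInfo_channel_le_logb_card (hb : 1 < b) {p : X → ℝ} (hp : p ∈ stdSimplex ℝ X)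
    (hW : IsChannel W) :
    mutualInfo b (fun x y => p x * W x y) ≤ logb b (Fintype.card Y) := by
  have hjoint : (fun k : X × Y => p k.1 * W k.1 k.2) ∈ stdSimplex ℝ (X × Y) := by
    refine ⟨fun k => mul_nonneg (hp.1 _) ((hW _).1 _), ?_⟩
    simp only [Fintype.sum_prod_type, ← mul_sum, (hW _).2, mul_one, hp.2]
  have h := mutualInfo_jointLaw_le_logb_card hb hjoint Prod.fst Prod.snd
  rwa [jointLaw_fst_snd fun x y => p x * W x y] at h

theorem mutualInfo_channel_le_capacity (hb : 1 < b) {p : X → ℝ} (hp : p ∈ stdSimplex ℝ X)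
    (hW : IsChannel W) : mutualInfo b (fun x y => p x * W x y) ≤ capacity b W := by
  refine le_csSup ⟨logb b (Fintype.card Y), ?_⟩ ⟨p, hp, rfl⟩
  rintro _ ⟨p', hp', rfl⟩
  exact mutualInfo_channel_le_logb_card hb hp' hW

theorem mutualInfo_selectedOutputs_le {κ ι : Type*} [Fintype κ] [DecidableEq κ] [Fintype ι]
    [DecidableEq ι] (hb : 1 < b) {p : I → ℝ} (hp : p ∈ stdSimplex ℝ I) (hW : IsChannel W)
    (x : κ → X) {e : I → ι → κ} (he : ∀ i, Function.Injective (e i)) :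
    mutualInfo b (jointLaw (prodLaw p (piLaw (W ∘ x))) Prod.fst fun k => k.2 ∘ e k.1) ≤
      Fintype.card ι * capacity b W := by
  have hK : IsChannel (W ∘ x) := fun t => hW (x t)
  have hμ := piLaw_mem_stdSimplex hK
  set m := prodLaw p (piLaw (W ∘ x))
  have hindex : law m Prod.fst = p :=
    (law_prodLaw_fst p hμ.2 id).trans (law_id p)
  have houtput : ∀ j, (jointLaw m Prod.fst fun k => (k.2 ∘ e k.1) j) =
      fun i z => p i * W (x (e i j)) z := by
    intro j
    funext i z
    rw [jointLaw_prodLaw_fst p _ (fun i ω => (ω ∘ e i) j)]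
    exact congrArg (p i * ·) (congrFun (law_piLaw_apply hK (e i j)) z)
  have hblock : ∀ i y, jointLaw m Prod.fst (fun k => k.2 ∘ e k.1) i y =
      p i * ∏ j, W (x (e i j)) (y j) := by
    intro i y
    rw [jointLaw_prodLaw_fst p _ (fun i ω => ω ∘ e i), law_piLaw_comp hK (he i)]
    rfl
  calc _ ≤ ∑ j, mutualInfo b (jointLaw m Prod.fst fun k => (k.2 ∘ e k.1) j) := by
        refine mutualInfo_jointLaw_le_sum_of_condIndep (p := m) hb (prodLaw_mem_stdSimplex hp hμ)
          _ _ fun i y => ?_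
        simp only [hblock, houtput, hindex]
        by_cases hi : p i = 0
        · simp [hi]
        · simp only [mul_div_cancel_left₀ _ hi]
    _ ≤ ∑ _j : ι, capacity b W := by
        refine sum_le_sum fun j _ => ?_
        rw [houtput, mutualInfo_channel_comp p hW]
        exact mutualInfo_channel_le_capacity hb (law_mem_stdSimplex hp _) hW
    _ = Fintype.card ι * capacity b W := by simp

end Channel

section DistortionRate

variable {U V : Type*} [Fintype U] [Fintype V] {b : ℝ} {ℓ : ℕ}

theorem exists_isChannel_mul_eq {A B : Type*} [Fintype B] [Nonempty B] {P : A → B → ℝ}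
    (hP : ∀ a c, 0 ≤ P a c) :
    ∃ Q : A → B → ℝ, IsChannel Q ∧ ∀ a c, (∑ c', P a c') * Q a c = P a c := by
  suffices h : ∀ a, ∃ q ∈ stdSimplex ℝ B, ∀ c, (∑ c', P a c') * q c = P a c by
    choose Q hQ hPQ using h
    exact ⟨Q, hQ, hPQ⟩
  intro a
  by_cases h : ∑ c, P a c = 0
  · refine ⟨_, uniform_mem_stdSimplex B, fun c => ?_⟩
    rw [h, zero_mul, (sum_eq_zero_iff_of_nonneg fun c _ => hP a c).1 h c (mem_univ c)]
  · refine ⟨fun c => P a c / ∑ c', P a c',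
      ⟨fun c => div_nonneg (hP a c) (sum_nonneg fun c' _ => hP a c'), ?_⟩,
      fun c => mul_div_cancel₀ _ h⟩
    rw [← sum_div, div_self h]

theorem empiricalDistortionRate_le_of_law_eq {Ω : Type*} [Fintype Ω] {p : Ω → ℝ}
    (hp : p ∈ stdSimplex ℝ Ω) (ρ : U → V → ℝ) {n : ℕ} {u : ℕ → U} {f : Ω → Fin ℓ → U}
    (g : Ω → Fin ℓ → V) (hf : law p f = empirical ℓ n u) {R : ℝ}
    (hR : mutualInfo b (jointLaw p f g) ≤ ℓ * R) :
    empiricalDistortionRate b ρ ℓ n u R ≤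
      ((1 / (ℓ : ℝ) * ∑ ω, p ω * ∑ j, ρ (f ω j) (g ω j) : ℝ) : EReal) := by
  obtain ⟨ω₀⟩ := nonempty_of_mem_stdSimplex hp
  have : Nonempty (Fin ℓ → V) := ⟨g ω₀⟩
  obtain ⟨Q, hQ, hPQ⟩ := exists_isChannel_mul_eq (P := jointLaw p f g)
    fun a c => law_nonneg hp.1 _ _
  simp only [sum_jointLaw_right, hf] at hPQ
  refine (iInf₂_le Q ⟨hQ, by simpa only [hPQ] using hR⟩).trans_eq ?_
  rw [← sum_law_mul p (fun ω => (f ω, g ω)) fun k => ∑ j, ρ (k.1 j) (k.2 j),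
    Fintype.sum_prod_type]
  simp only [blockDistortion, hPQ]
  rfl

theorem empiricalDistortionRate_antitone (b : ℝ) (ρ : U → V → ℝ) (ℓ n : ℕ) (u : ℕ → U) :
    Antitone (empiricalDistortionRate b ρ ℓ n u) :=
  fun _ _ h => biInf_mono fun _ hQ =>
    ⟨hQ.1, hQ.2.trans (mul_le_mul_of_nonneg_left h (Nat.cast_nonneg ℓ))⟩

end DistortionRate

section Blocks

variable {N ℓ : ℕ}

theorem empirical_eq_law {U : Type*} (hℓ : 0 < ℓ) (N : ℕ) (u : ℕ → U) :
    empirical ℓ (N * ℓ) u =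
      law (fun _ : Fin N => (Fintype.card (Fin N) : ℝ)⁻¹) fun i => block ℓ u i := by
  classical
  funext a
  have hcoeff : (ℓ : ℝ) / (N * ℓ : ℕ) = (N : ℝ)⁻¹ := by
    push_cast
    field_simp
  rw [empirical, hcoeff, Nat.mul_div_cancel _ hℓ,
    sum_range fun i => if block ℓ u i = a then _ else _]
  simp [law, mul_comm]

theorem sum_range_mul_eq_sum_blocks (N ℓ : ℕ) (F : ℕ → ℝ) :
    ∑ t ∈ range (N * ℓ), F t = ∑ i : Fin N, ∑ j : Fin ℓ, F (i * ℓ + j) := by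
  rw [sum_range, ← finProdFinEquiv.sum_comp, Fintype.sum_prod_type]
  simp [add_comm, mul_comm]

theorem sum_prodLaw_uniform_mul_sum_blocks {Ω : Type*} [Fintype Ω] (N ℓ : ℕ) (q : Ω → ℝ)
    (F : ℕ → Ω → ℝ) :
    1 / (ℓ : ℝ) * ∑ k, prodLaw (fun _ : Fin N => (Fintype.card (Fin N) : ℝ)⁻¹) q k *
        ∑ j : Fin ℓ, F (k.1 * ℓ + j) k.2 =
      1 / ((N * ℓ : ℕ) : ℝ) * ∑ t ∈ range (N * ℓ), ∑ ω, q ω * F t ω := by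
  have hcoeff : 1 / ((N * ℓ : ℕ) : ℝ) = 1 / (ℓ : ℝ) * (N : ℝ)⁻¹ := by
    push_cast
    rw [one_div, one_div, mul_inv, mul_comm]
  rw [sum_range_mul_eq_sum_blocks, hcoeff, mul_assoc]
  congr 1
  simp only [Fintype.sum_prod_type, prodLaw, Fintype.card_fin, mul_assoc, mul_sum]
  exact sum_congr rfl fun i _ => sum_comm

end Blocks

namespace Decoder

variable {ℓ : ℕ} {Y Z V : Type*}

theorem state_add_congr (dec : Decoder ℓ Y Z V) {n n' s s' m : ℕ} {y : Fin n → Y}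
    {y' : Fin n' → Y} (hs : (s : ZMod ℓ) = s') (hn : s + m ≤ n) (hn' : s' + m ≤ n')
    (hstate : dec.state y s = dec.state y' s')
    (hy : ∀ j (hj : j < m), y ⟨s + j, by omega⟩ = y' ⟨s' + j, by omega⟩) :
    dec.state y (s + m) = dec.state y' (s' + m) := by
  induction m with
  | zero => exact hstate
  | succ m ih =>
    have hprev := ih (by omega) (by omega) fun j hj => hy j (by omega)
    have hcounter : ((s + m + 1 : ℕ) : ZMod ℓ) = (s' + m + 1 : ℕ) := by
      push_cast
      rw [hs]
    rw [← add_assoc, ← add_assoc, state, state, dif_pos (by omega), dif_pos (by omega), hprev,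
      hcounter, hy m (by omega)]

-- Only the last `d` symbols of a block depend on later outputs. They are listed backwards here; if
-- `ℓ < d`, truncated subtraction merely repeats the first symbol of the block.
theorem block_reconstruct_factorsThrough (dec : Decoder ℓ Y Z V) (d N : ℕ)
    (tail : (Fin (N * ℓ) → Y) → ℕ → V) :
    (fun k : Fin N × (Fin (N * ℓ) → Y) => block ℓ (dec.reconstruct d tail k.2) k.1).FactorsThrough
      fun k => (k.2 ∘ fun j => finProdFinEquiv (k.1, j), dec.state k.2 (k.1 * ℓ),
        fun r : Fin d => dec.reconstruct d tail k.2 (k.1 * ℓ + (ℓ - 1 - r))) := by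
  rintro ⟨i, y⟩ ⟨i', y'⟩ h
  obtain ⟨hy, hstate, hlast⟩ : _ ∧ _ ∧ _ := by simpa only [Prod.mk.injEq] using h
  funext j
  have hblock : ∀ i : Fin N, (i : ℕ) * ℓ + ℓ ≤ N * ℓ := fun i => by
    rw [← Nat.succ_mul]
    exact Nat.mul_le_mul_right _ i.2
  have hi := hblock i
  have hi' := hblock i'
  have houtput : ∀ k (hk : k < ℓ), y ⟨i * ℓ + k, by omega⟩ = y' ⟨i' * ℓ + k, by omega⟩ := by
    intro k hk
    have := congrFun hy ⟨k, hk⟩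
    simpa [finProdFinEquiv, add_comm, mul_comm] using this
  change dec.reconstruct d tail y (i * ℓ + j) = dec.reconstruct d tail y' (i' * ℓ + j)
  by_cases hj : j + d < ℓ
  · have hcounter : ((i * ℓ + (j + d) + 1 : ℕ) : ZMod ℓ) = (i' * ℓ + (j + d) + 1 : ℕ) := by
      push_cast
      simp
    have hnow : dec.state y (i * ℓ + (j + d)) = dec.state y' (i' * ℓ + (j + d)) :=
      dec.state_add_congr (by simp) (by omega) (by omega) hstate
        fun k hk => houtput k (by omega)
    simp only [reconstruct, add_assoc]
    simp only [add_assoc] at hcounter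
    rw [dif_pos (by omega), dif_pos (by omega), hnow, hcounter, houtput (j + d) hj]
  · have := congrFun hlast ⟨ℓ - 1 - j, by omega⟩
    rwa [show ℓ - 1 - (ℓ - 1 - (j : ℕ)) = j by omega] at this

end Decoder

section Converse

variable {X Y V Z : Type*} [Fintype X] [Fintype Y] [Fintype V] [Fintype Z] {b : ℝ} {ℓ : ℕ}

theorem logb_card_prod_pi {d : ℕ} [Nonempty Z] [Nonempty V] :
    logb b (Fintype.card (Z × (Fin d → V))) =
      logb b (Fintype.card Z) + d * logb b (Fintype.card V) := by
  have hZ : (Fintype.card Z : ℝ) ≠ 0 := by simp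
  have hV : (Fintype.card V : ℝ) ≠ 0 := by simp
  simp only [Fintype.card_prod, Fintype.card_pi, prod_const, card_univ, Fintype.card_fin]
  push_cast
  rw [logb_mul hZ (pow_ne_zero d hV), logb_pow]

theorem mutualInfo_block_reconstruct_le (hb : 1 < b) {W : X → Y → ℝ} (hW : IsChannel W)
    {N : ℕ} {p : Fin N → ℝ} (hp : p ∈ stdSimplex ℝ (Fin N)) (x : ℕ → X)
    (dec : Decoder ℓ Y Z V) (d : ℕ) (tail : (Fin (N * ℓ) → Y) → ℕ → V) :
    mutualInfo b (jointLaw (prodLaw p (piLaw fun t : Fin (N * ℓ) => W (x t))) Prod.fst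
        fun k => block ℓ (dec.reconstruct d tail k.2) k.1) ≤
      ℓ * capacity b W + (logb b (Fintype.card Z) + d * logb b (Fintype.card V)) := by
  have hm := prodLaw_mem_stdSimplex hp (piLaw_mem_stdSimplex fun t : Fin (N * ℓ) => hW (x t))
  obtain ⟨i₀, y₀⟩ := nonempty_of_mem_stdSimplex hm
  have : Nonempty Z := ⟨dec.init⟩
  have : Nonempty V := ⟨dec.reconstruct d tail y₀ 0⟩
  have : Nonempty (Fin N) := ⟨i₀⟩
  have he : ∀ i : Fin N, Function.Injective fun j : Fin ℓ => finProdFinEquiv (i, j) :=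
    fun i => finProdFinEquiv.injective.comp (Prod.mk_right_injective i)
  refine (mutualInfo_jointLaw_le_of_factorsThrough hb hm.1 (fun _ _ h => h)
    (dec.block_reconstruct_factorsThrough d N tail)).trans ?_
  refine (mutualInfo_jointLaw_prodMk_le hb hm _ _ _).trans ?_
  rw [logb_card_prod_pi]
  gcongr
  exact (mutualInfo_selectedOutputs_le hb hp hW (fun t : Fin (N * ℓ) => x t) he).trans_eq
    (by rw [Fintype.card_fin])

end Converse

theorem logb_natCast_nonneg {b : ℝ} (hb : 1 < b) (m : ℕ) : 0 ≤ logb b m := by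
  rcases m.eq_zero_or_pos with rfl | hm
  · simp
  · exact logb_nonneg hb (by exact_mod_cast hm)

theorem correction_nonneg {b : ℝ} (hb : 1 < b) (J K L ℓ n : ℕ) :
    0 ≤ ((J : ℝ) * K) ^ ℓ * logb b L / √(n : ℝ) +
      ((J : ℝ) * K * L) ^ ℓ * logb b (exp 1) / (2 * n) := by
  have hL := logb_natCast_nonneg hb L
  have he : 0 ≤ logb b (exp 1) := logb_nonneg hb (one_le_exp zero_le_one)
  positivity

end SemiDet

open SemiDet in
theorem theorem1_general {U X Y V Z : Type*} [Fintype U] [Fintype X] [Fintype Y] [Fintype V]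
    [Fintype Z] {b : ℝ} (hb : 1 < b) {ℓ n : ℕ} (hn : 0 < n) (hℓn : ℓ ∣ n) (ρ : U → V → ℝ)
    {W : X → Y → ℝ} (hW : IsChannel W) (u : ℕ → U) (x : ℕ → X) (dec : Decoder ℓ Y Z V) (d : ℕ)
    (tail : (Fin n → Y) → ℕ → V) :
    empiricalDistortionRate b ρ ℓ n u (capacity b W +
        (Real.logb b (Fintype.card Z) + d * Real.logb b (Fintype.card V)) / ℓ)
      ≤ ((1 / (n : ℝ) * ∑ t ∈ Finset.range n, channelExpectation W x
          fun y : Fin n → Y => ρ (u t) (dec.reconstruct d tail y t) : ℝ) : EReal) := by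
  obtain ⟨N, rfl⟩ := exists_eq_mul_left_of_dvd hℓn
  have hℓ : 0 < ℓ := Nat.pos_of_mul_pos_left hn
  have : NeZero N := ⟨(Nat.pos_of_mul_pos_right hn).ne'⟩
  have hp := uniform_mem_stdSimplex (Fin N)
  have hμ := piLaw_mem_stdSimplex fun t : Fin (N * ℓ) => hW (x t)
  have hm := prodLaw_mem_stdSimplex hp hμ
  have hlaw := (law_prodLaw_fst _ hμ.2 fun i : Fin N => block ℓ u i).trans
    (empirical_eq_law hℓ N u).symm
  refine (empiricalDistortionRate_le_of_law_eq hm ρ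
    (fun k => block ℓ (dec.reconstruct d tail k.2) k.1) hlaw ?_).trans_eq ?_
  · have : Nonempty (Fin ℓ → U) := ⟨block ℓ u 0⟩
    obtain ⟨-, y₀⟩ := nonempty_of_mem_stdSimplex hm
    have : Nonempty (Fin ℓ → V) := ⟨block ℓ (dec.reconstruct d tail y₀) 0⟩
    refine (mutualInfo_jointLaw_le_of_factorsThrough hb hm.1 (f := Prod.fst)
      (fun _ _ h => by rw [h]) fun _ _ h => h).trans ?_
    refine (mutualInfo_block_reconstruct_le hb hW hp x dec d tail).trans_eq ?_
    field_simp
  · exact congrArg Real.toEReal (sum_prodLaw_uniform_mul_sum_blocks N ℓ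
      (piLaw fun t : Fin (N * ℓ) => W (x t)) fun t y => ρ (u t) (dec.reconstruct d tail y t))

theorem theorem1 (b : ℝ) (hb : 1 < b) (J K L ℓ : ℕ) (hℓ : 0 < ℓ) :
    ∃ r : ℕ → ℝ, (r =o[atTop] fun n : ℕ => 1 / √(n : ℝ)) ∧
      ∀ (U X Y V Z : Type*) [Fintype U] [Fintype X] [Fintype Y] [Fintype V] [Fintype Z],
        Fintype.card U = J → Fintype.card X = K → Fintype.card Y = L →
        ∀ (ρ : U → V → ℝ) (W : X → Y → ℝ), SemiDet.IsChannel W →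
        ∀ (u : ℕ → U) (enc : (ℕ → U) → ℕ → X) (dec : SemiDet.Decoder ℓ Y Z V)
          (d n : ℕ) (tail : (Fin n → Y) → ℕ → V), 0 < n → ℓ ∣ n →
          SemiDet.empiricalDistortionRate b ρ ℓ n u
              (SemiDet.capacity b W
                + (2 * Real.logb b (Fintype.card Z) + d * Real.logb b (Fintype.card V)) / ℓ
                + (((J : ℝ) * K) ^ ℓ * Real.logb b L / √(n : ℝ)
                  + ((J : ℝ) * K * L) ^ ℓ * Real.logb b (Real.exp 1) / (2 * n)
                  + r n))
            ≤ ((1 / (n : ℝ) * ∑ t ∈ Finset.range n,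
                SemiDet.channelExpectation W (enc u)
                  (fun y : Fin n → Y => ρ (u t) (dec.reconstruct d tail y t)) : ℝ) : EReal) := by
  refine ⟨0, isLittleO_zero _ _, fun U X Y V Z _ _ _ _ _ _ _ _ ρ W hW u enc dec d n tail hn hℓn =>
    (SemiDet.empiricalDistortionRate_antitone b ρ ℓ n u ?_).trans
      (theorem1_general hb hn hℓn ρ hW u (enc u) dec d tail)⟩
  refine le_add_of_le_of_nonneg ?_ (by simpa using SemiDet.correction_nonneg hb J K L ℓ n)
  gcongr
  exact le_mul_of_one_le_left (SemiDet.logb_natCast_nonneg hb _) one_le_two
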